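/- Let $n\ge 1$, let $K=\mathbf{Q}(\zeta_n)\cap\mathbf{R}$ be the (maximal) real subfield of the $n$-th cyclotomic field, let $R$ be the ring of integers of $K$, and let $A=(-1,-1)_K$ be the quaternion algebra over $K$ with basis $1,i,j,k$ and relations $i^2=j^2=-1$, $ij=-ji=k$. An order of $A$ is a subring of $A$ containing $1$ that is a finitely generated $R$-submodule of $A$ and spans $A$ over $K$; it is a maximal order if it is not properly contained in any other order. For a subgroup $G$ of $A^*$, let $R[G]\subset A$ denote the set of $R$-linear combinations of the elements of $G$. Let $G$ be a subgroup of $A^*$ that is isomorphic either to the Clifford group (the binary octahedral group) of order $48$, i.e. the group of real quaternions generated by $i$, $j$, $(1-i-j-k)/2$ and $(i-j)/\sqrt2$, or to the binary icosahedral group $\mathrm{SL}(2,5)$ of order $120$. Then $R[G]$ is a maximal order of $A$. -/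

import Mathlib

open scoped NumberField Quaternion

/-- Let `R` be a commutative ring, `K` a field and `A` an algebra over both (in use: `R` is the ring
of integers of the number field `K` and `A` is a quaternion algebra over `K`). An *order* of `A` is
a subring of `A` containing `1` that is a full `R`-lattice in `A`: a finitely generated
`R`-submodule that spans `A` over `K`. -/
structure IsOrder (R K : Type*) {A : Type*} [CommRing R] [Field K] [Ring A] [Algebra R A]
    [Algebra K A] (O : Submodule R A) : Prop where
  one_mem : (1 : A) ∈ O
  mul_mem : ∀ x ∈ O, ∀ y ∈ O, x * y ∈ O
  fg : O.FG
  span_eq_top : Submodule.span K (O : Set A) = ⊤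

/-- A *maximal order* of `A` is an order that is not properly contained in any other order. -/
def IsMaximalOrder (R K : Type*) {A : Type*} [CommRing R] [Field K] [Ring A] [Algebra R A]
    [Algebra K A] (O : Submodule R A) : Prop :=
  IsOrder R K O ∧ ∀ O' : Submodule R A, IsOrder R K O' → O ≤ O' → O' = O

/-- `R[G]`: the set of `R`-linear combinations, inside `A`, of the elements of a subgroup `G` of the
multiplicative group of `A`. -/
def groupSpan (R : Type*) {A : Type*} [CommRing R] [Ring A] [Algebra R A] (G : Subgroup Aˣ) :
    Submodule R A :=
  Submodule.span R ((fun g : Aˣ => (g : A)) '' (G : Set Aˣ))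

/-- The binary octahedral group (of order 48), also called the Clifford group: the group of real
quaternions generated by `i`, `j`, `(1 - i - j - k) / 2` and `(i - j) / √2`. The four coordinates
of a quaternion are taken with respect to the basis `1, i, j, k`. -/
noncomputable def cliffordGroup : Subgroup ℍ[ℝ]ˣ :=
  Subgroup.closure {u : ℍ[ℝ]ˣ |
    (u : ℍ[ℝ]) = ⟨0, 1, 0, 0⟩ ∨
    (u : ℍ[ℝ]) = ⟨0, 0, 1, 0⟩ ∨
    (u : ℍ[ℝ]) = ⟨1 / 2, -1 / 2, -1 / 2, -1 / 2⟩ ∨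
    (u : ℍ[ℝ]) = ⟨0, 1 / √2, -1 / √2, 0⟩}

/-- The binary icosahedral group (of order 120), realized as `SL(2, 5)`. -/
abbrev BinaryIcosahedralGroup : Type :=
  Matrix.SpecialLinearGroup (Fin 2) (ZMod 5)

/-! Both groups are finite and contain `a`, `b` whose commutator `c` has order 6. Then `c ^ 2 - c +
1 = 0`, so `c - 1 = c ^ 2` has reduced norm 1, and so has `d = ab - ba = (c - 1)ba`. The norm of `d`
generates the reduced discriminant of the lattice on `1, a, b, ab`, so this lattice is self-dual for
the reduced trace. An element `x` of a larger order has integral traces against `R[G]`, and these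
are its coordinates in `1, a, b, ab`; hence `x` lies in `R[G]` (`isMaximalOrder_groupSpan`). -/

open scoped commutatorElement

/-! ### Trace-dual basis and integrality of reduced traces -/

section Field

variable {K : Type*} [Field K]

/-- Expansion of a quaternion in the elements `1`, `a`, `b`, `a * b`, by means of the dual basis
with respect to the reduced trace. -/
theorem normSq_commutator_smul_eq (a b x : ℍ[K]) :
    Quaternion.normSq (a * b - b * a) • x =
      (2 * (x * (a * b - b * a) * star a).re) • b + (2 * (x * (star b * (a * b - b * a))).re) • a
        - (2 * (x * (a * b - b * a)).re) • (a * b)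
        - (2 * (x * (star b * (a * b - b * a) * star a)).re) • (1 : ℍ[K]) := by
  ext <;> simp [Quaternion.normSq_def'] <;> ring

-- `star x` is a root of the same monic polynomial as `x` and commutes with it, so the two can be
-- added as integral elements of a commutative subalgebra.
open scoped IsMulCommutative in
theorem isIntegral_two_mul_re {R : Type*} [CommRing R] [Algebra R K] {x : ℍ[K]}
    (hx : IsIntegral R x) : IsIntegral R (2 * x.re) := by
  have hs : IsIntegral R (star x) := by
    obtain ⟨p, hp, h0⟩ := hx
    refine ⟨p, hp, ?_⟩
    have key : ∀ q : Polynomial R, Polynomial.aeval (star x) q = star (Polynomial.aeval x q) := by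
      intro q
      induction q using Polynomial.induction_on' with
      | add p q hp hq => simp [hp, hq]
      | monomial n r =>
        rw [Polynomial.aeval_monomial, Polynomial.aeval_monomial, ← Algebra.smul_def,
          ← Algebra.smul_def, Quaternion.star_smul, star_pow]
    have := key p
    rw [Polynomial.aeval_def, Polynomial.aeval_def, h0, star_zero] at this
    exact this
  have hc : Commute x (star x) := by
    rw [commute_iff_eq, Quaternion.self_mul_star, Quaternion.star_mul_self]
  let S := Algebra.adjoin R ({x, star x} : Set ℍ[K])
  have : IsMulCommutative S := by
    refine Algebra.isMulCommutative_adjoin R ?_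
    rintro y (rfl | rfl) z (rfl | rfl)
    exacts [rfl, hc, hc.symm, rfl]
  have hxS : x ∈ S := Algebra.subset_adjoin (by simp)
  have hsS : star x ∈ S := Algebra.subset_adjoin (by simp)
  have hi : Function.Injective S.val := Subtype.val_injective
  have h1 : IsIntegral R (⟨x, hxS⟩ : S) := (isIntegral_algHom_iff S.val hi).1 hx
  have h2 : IsIntegral R (⟨star x, hsS⟩ : S) := (isIntegral_algHom_iff S.val hi).1 hs
  have h3 : IsIntegral R (x + star x) := (h1.add h2).map S.val
  rw [Quaternion.self_add_star'] at h3
  exact (isIntegral_algHom_iff ((Algebra.ofId K ℍ[K]).restrictScalars R)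
    (algebraMap K ℍ[K]).injective).1 h3

theorem exists_ringOfIntegers_eq_two_mul_re {O : Submodule (𝓞 K) ℍ[K]} (h1 : (1 : ℍ[K]) ∈ O)
    (hmul : ∀ x ∈ O, ∀ y ∈ O, x * y ∈ O) (hfg : O.FG) {x : ℍ[K]} (hx : x ∈ O) :
    ∃ r : 𝓞 K, (r : K) = 2 * x.re := by
  let S : Subalgebra (𝓞 K) ℍ[K] := O.toSubalgebra h1 fun x y hx hy => hmul x hx y hy
  have hS : S.toSubmodule.FG := (O.toSubalgebra_toSubmodule h1 _).symm ▸ hfg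
  have h2 := isIntegral_two_mul_re (IsIntegral.of_mem_of_fg S hS x hx)
  exact ⟨⟨2 * x.re, isIntegral_trans (R := ℤ) (A := 𝓞 K) _ h2⟩, rfl⟩

theorem mul_mem_groupSpan {R : Type*} [CommRing R] [Algebra R K] (G : Subgroup ℍ[K]ˣ)
    {x y : ℍ[K]} (hx : x ∈ groupSpan R G) (hy : y ∈ groupSpan R G) : x * y ∈ groupSpan R G := by
  have h := Submodule.mul_mem_mul hx hy
  unfold groupSpan at h ⊢
  rw [Submodule.span_mul_span] at h
  refine Submodule.span_mono ?_ h
  rintro _ ⟨_, ⟨g, hg, rfl⟩, _, ⟨g', hg', rfl⟩, rfl⟩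
  exact ⟨g * g', G.mul_mem hg hg', by simp⟩

end Field

/-! ### The maximality criterion -/

section Ordered

variable {K : Type*} [Field K] [LinearOrder K] [IsStrictOrderedRing K]

theorem normSq_eq_one_of_pow_eq_one {x : ℍ[K]} {m : ℕ} (hm : m ≠ 0) (hx : x ^ m = 1) :
    Quaternion.normSq x = 1 := by
  have : Quaternion.normSq x ^ m = 1 := by rw [← map_pow, hx, map_one]
  exact (pow_eq_one_iff_of_nonneg Quaternion.normSq_nonneg hm).1 this

/-- If a finite group of quaternions contains a commutator of order `6`, then its `𝓞 K`-span is
an order of reduced discriminant one, hence maximal. -/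
theorem isMaximalOrder_groupSpan (G : Subgroup ℍ[K]ˣ) [Finite G] {a b : ℍ[K]ˣ} (ha : a ∈ G)
    (hb : b ∈ G) (hc : orderOf ⁅a, b⁆ = 6) : IsMaximalOrder (𝓞 K) K (groupSpan (𝓞 K) G) := by
  have hmem : ∀ g ∈ G, (g : ℍ[K]) ∈ groupSpan (𝓞 K) G := fun g hg =>
    Submodule.subset_span ⟨g, hg, rfl⟩
  have hone : (1 : ℍ[K]) ∈ groupSpan (𝓞 K) G := by simpa using hmem 1 G.one_mem
  have hfg : (groupSpan (𝓞 K) G).FG := Submodule.fg_span ((Set.toFinite _).image _)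
  have hnorm : ∀ g ∈ G, Quaternion.normSq (g : ℍ[K]) = 1 := by
    intro g hg
    have h : (⟨g, hg⟩ : G) ^ Nat.card G = 1 := pow_card_eq_one'
    refine normSq_eq_one_of_pow_eq_one (m := Nat.card G) Nat.card_pos.ne' ?_
    have h' := congrArg (fun u : G => ((u : ℍ[K]ˣ) : ℍ[K])) h
    simpa only [Subgroup.coe_pow, Units.val_pow_eq_pow_val, Subgroup.coe_one, Units.val_one]
      using h'
  have hstar : ∀ g ∈ G, star (g : ℍ[K]) ∈ groupSpan (𝓞 K) G := by
    intro g hg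
    have : star (g : ℍ[K]) = ((g⁻¹ : ℍ[K]ˣ) : ℍ[K]) := by
      apply Units.eq_inv_of_mul_eq_one_right
      rw [Quaternion.star_mul_self, hnorm g hg, Quaternion.coe_one]
    rw [this]
    exact hmem _ (G.inv_mem hg)
  set c : ℍ[K] := ((⁅a, b⁆ : ℍ[K]ˣ) : ℍ[K]) with hcdef
  have hord : orderOf c = 6 := by rw [hcdef, orderOf_units, hc]
  have hc6 : c ^ 6 = 1 := hord ▸ pow_orderOf_eq_one c
  have hc3 : c ^ 3 ≠ 1 := pow_ne_one_of_lt_orderOf (by norm_num) (by rw [hord]; norm_num)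
  have hc2 : c ^ 2 ≠ 1 := pow_ne_one_of_lt_orderOf (by norm_num) (by rw [hord]; norm_num)
  have hc3' : c ^ 3 = -1 := by
    have : (c ^ 3 - 1) * (c ^ 3 + 1) = 0 := by
      have : (c ^ 3 - 1) * (c ^ 3 + 1) = c ^ 6 - 1 := by noncomm_ring
      rw [this, hc6, sub_self]
    exact eq_neg_of_add_eq_zero_left ((mul_eq_zero.1 this).resolve_left (sub_ne_zero.2 hc3))
  -- Positivity of the norm makes the quaternions a division ring, so `c` is a root of the sixth
  -- cyclotomic polynomial.
  have hquad : c ^ 2 - c + 1 = 0 := by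
    have : (c + 1) * (c ^ 2 - c + 1) = 0 := by
      have : (c + 1) * (c ^ 2 - c + 1) = c ^ 3 + 1 := by noncomm_ring
      rw [this, hc3', neg_add_cancel]
    refine (mul_eq_zero.1 this).resolve_left fun h => hc2 ?_
    rw [eq_neg_of_add_eq_zero_left h]; norm_num
  have hd1 : Quaternion.normSq (c - 1) = 1 := by
    have h : (c - 1) ^ 2 = -c := by
      have : (c - 1) ^ 2 = (c ^ 2 - c + 1) - c := by noncomm_ring
      rw [this, hquad, zero_sub]
    refine normSq_eq_one_of_pow_eq_one (m := 12) (by norm_num) ?_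
    rw [show 12 = 2 * 6 from rfl, pow_mul, h, Even.neg_pow ⟨3, rfl⟩, hc6]
  set d : ℍ[K] := a * b - b * a with hd
  have hdc : d = (c - 1) * (b * a) := by
    have : (⁅a, b⁆ : ℍ[K]ˣ) * (b * a) = a * b := by
      rw [commutatorElement_def]; group
    have h' := congrArg (fun u : ℍ[K]ˣ => (u : ℍ[K])) this
    rw [sub_mul, one_mul, hd]
    simp only [Units.val_mul] at h' ⊢
    rw [← h']
  have hdn : Quaternion.normSq d = 1 := by
    rw [hdc, map_mul, map_mul, hd1, hnorm a ha, hnorm b hb]; norm_num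
  have hab : (a : ℍ[K]) * b ∈ groupSpan (𝓞 K) G := mul_mem_groupSpan G (hmem a ha) (hmem b hb)
  have hdm : d ∈ groupSpan (𝓞 K) G :=
    Submodule.sub_mem _ hab (mul_mem_groupSpan G (hmem b hb) (hmem a ha))
  have hexp := fun x => normSq_commutator_smul_eq (a : ℍ[K]) b x
  simp only [← hd, hdn, one_smul] at hexp
  refine ⟨⟨hone, fun x hx y hy => mul_mem_groupSpan G hx hy, hfg, ?_⟩, ?_⟩
  · rw [eq_top_iff]
    rintro x -
    rw [hexp x]
    have hm : ∀ y ∈ groupSpan (𝓞 K) G, ∀ r : K,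
        r • y ∈ Submodule.span K (groupSpan (𝓞 K) G : Set ℍ[K]) := fun y hy r =>
      Submodule.smul_mem _ _ (Submodule.subset_span hy)
    exact Submodule.sub_mem _ (Submodule.sub_mem _ (Submodule.add_mem _ (hm _ (hmem b hb) _)
      (hm _ (hmem a ha) _)) (hm _ hab _)) (hm _ hone _)
  · intro O' hO' hle
    refine le_antisymm (fun x hx => ?_) hle
    -- The dual basis is built from `d`, `star a` and `star b`, all in `R[G]`, so each coordinate of
    -- `x` is, up to sign, a trace of this form.
    have hm : ∀ y ∈ groupSpan (𝓞 K) G, ∀ z ∈ groupSpan (𝓞 K) G,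
        (2 * (x * y).re) • z ∈ groupSpan (𝓞 K) G := by
      intro y hy z hz
      obtain ⟨r, hr⟩ := exists_ringOfIntegers_eq_two_mul_re hO'.one_mem hO'.mul_mem hO'.fg
        (hO'.mul_mem x hx y (hle hy))
      rw [← hr]
      exact Submodule.smul_mem _ r hz
    rw [hexp x, mul_assoc]
    have hsd := mul_mem_groupSpan G (hstar b hb) hdm
    exact Submodule.sub_mem _ (Submodule.sub_mem _ (Submodule.add_mem _
      (hm _ (mul_mem_groupSpan G hdm (hstar a ha)) _ (hmem b hb))
      (hm _ hsd _ (hmem a ha))) (hm _ hdm _ hab))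
      (hm _ (mul_mem_groupSpan G hsd (hstar a ha)) _ hone)

end Ordered

/-! ### Coordinate arithmetic -/

namespace Quaternion

variable {R : Type*} [CommRing R]

/-- The quaternion with the given coordinates. -/
def ofCoords (a₁ a₂ a₃ a₄ : R) : ℍ[R] := ⟨a₁, a₂, a₃, a₄⟩

@[simp]
theorem re_ofCoords (a₁ a₂ a₃ a₄ : R) : (ofCoords a₁ a₂ a₃ a₄).re = a₁ := rfl

@[simp]
theorem imI_ofCoords (a₁ a₂ a₃ a₄ : R) : (ofCoords a₁ a₂ a₃ a₄).imI = a₂ := rfl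

@[simp]
theorem imJ_ofCoords (a₁ a₂ a₃ a₄ : R) : (ofCoords a₁ a₂ a₃ a₄).imJ = a₃ := rfl

@[simp]
theorem imK_ofCoords (a₁ a₂ a₃ a₄ : R) : (ofCoords a₁ a₂ a₃ a₄).imK = a₄ := rfl

theorem ofCoords_mul_ofCoords (a₁ a₂ a₃ a₄ b₁ b₂ b₃ b₄ : R) :
    ofCoords a₁ a₂ a₃ a₄ * ofCoords b₁ b₂ b₃ b₄ =
      ofCoords (a₁ * b₁ - a₂ * b₂ - a₃ * b₃ - a₄ * b₄) (a₁ * b₂ + a₂ * b₁ + a₃ * b₄ - a₄ * b₃)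
        (a₁ * b₃ - a₂ * b₄ + a₃ * b₁ + a₄ * b₂) (a₁ * b₄ + a₂ * b₃ - a₃ * b₂ + a₄ * b₁) := by
  ext
  exacts [re_mul _ _, imI_mul _ _, imJ_mul _ _, imK_mul _ _]

theorem star_ofCoords (a₁ a₂ a₃ a₄ : R) :
    star (ofCoords a₁ a₂ a₃ a₄) = ofCoords a₁ (-a₂) (-a₃) (-a₄) := by
  ext
  exacts [re_star _, imI_star _, imJ_star _, imK_star _]

theorem ofCoords_inj {a₁ a₂ a₃ a₄ b₁ b₂ b₃ b₄ : R} :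
    ofCoords a₁ a₂ a₃ a₄ = ofCoords b₁ b₂ b₃ b₄ ↔ a₁ = b₁ ∧ a₂ = b₂ ∧ a₃ = b₃ ∧ a₄ = b₄ :=
  Quaternion.ext_iff

theorem one_eq_ofCoords : (1 : ℍ[R]) = ofCoords 1 0 0 0 := rfl

theorem normSq_ofCoords (a₁ a₂ a₃ a₄ : R) :
    normSq (ofCoords a₁ a₂ a₃ a₄) = a₁ ^ 2 + a₂ ^ 2 + a₃ ^ 2 + a₄ ^ 2 := normSq_def' _

end Quaternion

/-! ### Commutators of order 6 in the two groups -/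

section FiniteGroups

open Quaternion

theorem BinaryIcosahedralGroup.exists_orderOf_commutator_eq_six :
    ∃ a b : BinaryIcosahedralGroup, orderOf ⁅a, b⁆ = 6 := by
  -- With off-diagonal entries `s`, `t` the commutator has trace `2 + (st)²`. Order 6 means trace 1,
  -- so `st = ±2` modulo 5.
  refine ⟨⟨!![1, 1; 0, 1], by decide⟩, ⟨!![1, 0; 2, 1], by decide⟩, ?_⟩
  rw [orderOf_eq_iff (by norm_num)]
  refine ⟨by decide +kernel, fun m hm h0 => ?_⟩
  interval_cases m <;> decide +kernel

/-- The vectors `±i`, `±j`, `±k`. -/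
def quaternionAxes : Set ℍ[ℝ] :=
  {ofCoords 0 1 0 0, ofCoords 0 (-1) 0 0, ofCoords 0 0 1 0, ofCoords 0 0 (-1) 0,
    ofCoords 0 0 0 1, ofCoords 0 0 0 (-1)}

/-- Conjugation by either `u` or `star u` is tracked so that the induction passes to inverses. -/
theorem cliffordGroup_preserves_axes {u : ℍ[ℝ]ˣ} (hu : u ∈ cliffordGroup) :
    normSq (u : ℍ[ℝ]) = 1 ∧ ∀ v ∈ quaternionAxes,
      (u : ℍ[ℝ]) * v * star (u : ℍ[ℝ]) ∈ quaternionAxes ∧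
      star (u : ℍ[ℝ]) * v * (u : ℍ[ℝ]) ∈ quaternionAxes := by
  have h2 : (√2)⁻¹ * (√2)⁻¹ = (1 / 2 : ℝ) := by
    rw [← mul_inv, Real.mul_self_sqrt (by norm_num)]; norm_num
  induction hu using Subgroup.closure_induction with
  | mem u hu =>
    obtain h | h | h | h : (u : ℍ[ℝ]) = ofCoords 0 1 0 0 ∨ (u : ℍ[ℝ]) = ofCoords 0 0 1 0 ∨
        (u : ℍ[ℝ]) = ofCoords (1 / 2) (-1 / 2) (-1 / 2) (-1 / 2) ∨
        (u : ℍ[ℝ]) = ofCoords 0 (1 / √2) (-1 / √2) 0 := hu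
    all_goals rw [h]; refine ⟨?_, ?_⟩
    all_goals first
      | (rw [normSq_ofCoords]; norm_num [div_pow])
      | (rintro v (rfl | rfl | rfl | rfl | rfl | rfl) <;>
          simp only [star_ofCoords, ofCoords_mul_ofCoords, quaternionAxes,
            Set.mem_insert_iff, Set.mem_singleton_iff, ofCoords_inj] <;>
          norm_num [h2, div_eq_mul_inv])
  | one => simp
  | mul u w _ _ hu hw =>
    refine ⟨by rw [Units.val_mul, map_mul, hu.1, hw.1, one_mul], fun v hv => ⟨?_, ?_⟩⟩
    · have := (hu.2 _ (hw.2 v hv).1).1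
      simpa [mul_assoc] using this
    · have := (hw.2 _ (hu.2 v hv).2).2
      simpa [mul_assoc] using this
  | inv u _ hu =>
    have : ((u⁻¹ : ℍ[ℝ]ˣ) : ℍ[ℝ]) = star (u : ℍ[ℝ]) :=
      (Units.eq_inv_of_mul_eq_one_right
        (by rw [star_mul_self, hu.1, coe_one])).symm
    rw [this, star_star, normSq_star]
    exact ⟨hu.1, fun v hv => (hu.2 v hv).symm⟩

/-- The diagonal entries of the rotation given by a unit quaternion determine the squares of its
coordinates. Here those entries are `0` or `±1`, so each coordinate takes finitely many values. -/
instance finite_cliffordGroup : Finite cliffordGroup := by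
  let D : Set ℝ := {-1, 0, 1}
  let F : Set ℝ := (fun p : ℝ × ℝ × ℝ × ℝ => (p.1 + p.2.1 + p.2.2.1 + p.2.2.2) / 4) ''
    (({1} : Set ℝ) ×ˢ (D ×ˢ (D ×ˢ D)))
  have hF : F.Finite := Set.toFinite _
  let E : Set ℝ := Real.sqrt '' F ∪ (fun x => -Real.sqrt x) '' F
  have hE : E.Finite := (hF.image _).union (hF.image _)
  have hD : ∀ v ∈ quaternionAxes, (v.imI ∈ D ∧ -v.imI ∈ D) ∧ (v.imJ ∈ D ∧ -v.imJ ∈ D) ∧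
      (v.imK ∈ D ∧ -v.imK ∈ D) := by
    rintro v (rfl | rfl | rfl | rfl | rfl | rfl) <;> simp [D]
  have hsq : ∀ x : ℝ, ∀ p ∈ D, ∀ q ∈ D, ∀ r ∈ D, 4 * x ^ 2 = 1 + p + q + r → x ∈ E := by
    intro x p hp q hq r hr h
    have hx : x ^ 2 ∈ F := ⟨(1, p, q, r), ⟨rfl, hp, hq, hr⟩, by dsimp only; linarith⟩
    rcases le_total 0 x with h0 | h0
    · exact Or.inl ⟨_, hx, Real.sqrt_sq h0⟩
    · refine Or.inr ⟨_, hx, ?_⟩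
      simp [Real.sqrt_sq_eq_abs, abs_of_nonpos h0]
  have hcoord : ∀ u ∈ cliffordGroup, (u : ℍ[ℝ]).re ∈ E ∧ (u : ℍ[ℝ]).imI ∈ E ∧
      (u : ℍ[ℝ]).imJ ∈ E ∧ (u : ℍ[ℝ]).imK ∈ E := by
    intro u hu
    obtain ⟨hn, hv⟩ := cliffordGroup_preserves_axes hu
    obtain ⟨⟨hi, hi'⟩, -, -⟩ := hD _ (hv (ofCoords 0 1 0 0) (Or.inl rfl)).1
    obtain ⟨-, ⟨hj, hj'⟩, -⟩ := hD _ (hv (ofCoords 0 0 1 0) (Or.inr (Or.inr (Or.inl rfl)))).1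
    obtain ⟨-, -, ⟨hk, hk'⟩⟩ := hD _ (hv (ofCoords 0 0 0 1)
      (Or.inr (Or.inr (Or.inr (Or.inr (Or.inl rfl)))))).1
    generalize (u : ℍ[ℝ]) = q at *
    obtain ⟨a, b, c, d, rfl⟩ : ∃ a b c d, q = ofCoords a b c d :=
      ⟨_, _, _, _, rfl⟩
    rw [normSq_ofCoords] at hn
    rw [star_ofCoords, ofCoords_mul_ofCoords, ofCoords_mul_ofCoords] at hi hi' hj hj' hk hk'
    simp only [re_ofCoords, imI_ofCoords, imJ_ofCoords, imK_ofCoords] at hi hi' hj hj' hk hk' ⊢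
    refine ⟨hsq _ _ hi _ hj _ hk ?_, hsq _ _ hi _ hj' _ hk' ?_, hsq _ _ hi' _ hj _ hk' ?_,
      hsq _ _ hi' _ hj' _ hk ?_⟩ <;> linear_combination hn
  have : Finite E := hE
  refine Finite.of_injective (β := E × E × E × E) (fun u : cliffordGroup =>
    (⟨_, (hcoord u u.2).1⟩, ⟨_, (hcoord u u.2).2.1⟩, ⟨_, (hcoord u u.2).2.2.1⟩,
      ⟨_, (hcoord u u.2).2.2.2⟩)) ?_
  intro u w h
  simp only [Prod.mk.injEq, Subtype.mk.injEq] at h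
  exact Subtype.ext (Units.ext (Quaternion.ext _ _ h.1 h.2.1 h.2.2.1 h.2.2.2))

theorem orderOf_ofCoords_half :
    orderOf (ofCoords (1 / 2) (-1 / 2) (-1 / 2) (-1 / 2) : ℍ[ℝ]) = 6 := by
  set q : ℍ[ℝ] := ofCoords (1 / 2) (-1 / 2) (-1 / 2) (-1 / 2) with hq
  have hq2 : q ^ 2 = ofCoords (-1 / 2) (-1 / 2) (-1 / 2) (-1 / 2) := by
    rw [hq, sq, ofCoords_mul_ofCoords, ofCoords_inj]; norm_num
  have hq3 : q ^ 3 = ofCoords (-1) 0 0 0 := by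
    rw [pow_succ, hq2, hq, ofCoords_mul_ofCoords, ofCoords_inj]; norm_num
  refine orderOf_eq_of_pow_and_pow_div_prime (by norm_num) ?_ fun p hp hp6 => ?_
  · rw [show 6 = 3 * 2 from rfl, pow_mul, hq3, sq, ofCoords_mul_ofCoords, one_eq_ofCoords,
      ofCoords_inj]
    norm_num
  · obtain rfl | rfl : p = 2 ∨ p = 3 := by
      have := Nat.le_of_dvd (by norm_num) hp6
      interval_cases p <;> revert hp hp6 <;> norm_num
    · rw [show 6 / 2 = 3 from rfl, hq3, one_eq_ofCoords, ne_eq, ofCoords_inj]; norm_num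
    · rw [show 6 / 3 = 2 from rfl, hq2, one_eq_ofCoords, ne_eq, ofCoords_inj]; norm_num

theorem cliffordGroup_exists_orderOf_commutator_eq_six :
    ∃ a b : cliffordGroup, orderOf ⁅a, b⁆ = 6 := by
  have h2 : (√2)⁻¹ * (√2)⁻¹ = (1 / 2 : ℝ) := by
    rw [← mul_inv, Real.mul_self_sqrt (by norm_num)]; norm_num
  let i : ℍ[ℝ]ˣ := ⟨ofCoords 0 1 0 0, ofCoords 0 (-1) 0 0,
    by rw [ofCoords_mul_ofCoords, one_eq_ofCoords]; norm_num,
    by rw [ofCoords_mul_ofCoords, one_eq_ofCoords]; norm_num⟩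
  let w : ℍ[ℝ]ˣ := ⟨ofCoords (1 / 2) (-1 / 2) (-1 / 2) (-1 / 2),
    ofCoords (1 / 2) (1 / 2) (1 / 2) (1 / 2),
    by rw [ofCoords_mul_ofCoords, one_eq_ofCoords]; norm_num,
    by rw [ofCoords_mul_ofCoords, one_eq_ofCoords]; norm_num⟩
  let t : ℍ[ℝ]ˣ := ⟨ofCoords 0 (1 / √2) (-1 / √2) 0, ofCoords 0 (-1 / √2) (1 / √2) 0,
    by rw [ofCoords_mul_ofCoords, one_eq_ofCoords]; norm_num [h2, div_eq_mul_inv],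
    by rw [ofCoords_mul_ofCoords, one_eq_ofCoords]; norm_num [h2, div_eq_mul_inv]⟩
  have hi : i ∈ cliffordGroup := Subgroup.subset_closure (Or.inl rfl)
  have hw : w ∈ cliffordGroup := Subgroup.subset_closure (Or.inr (Or.inr (Or.inl rfl)))
  have ht : t ∈ cliffordGroup := Subgroup.subset_closure (Or.inr (Or.inr (Or.inr rfl)))
  -- `t` conjugates `w` to `w⁻¹`, so `⁅t, w⁆ = w⁻²` has order only 3; replacing `w` by its conjugate
  -- makes the commutator `w` itself.
  refine ⟨⟨t, ht⟩, ⟨i * w * i⁻¹, mul_mem (mul_mem hi hw) (inv_mem hi)⟩, ?_⟩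
  rw [← Subgroup.orderOf_coe, ← orderOf_units]
  have hc : ((⁅t, i * w * i⁻¹⁆ : ℍ[ℝ]ˣ) : ℍ[ℝ]) =
      ofCoords (1 / 2) (-1 / 2) (-1 / 2) (-1 / 2) := by
    have hi' : ((i⁻¹ : ℍ[ℝ]ˣ) : ℍ[ℝ]) = ofCoords 0 (-1) 0 0 := rfl
    have hw' : ((w⁻¹ : ℍ[ℝ]ˣ) : ℍ[ℝ]) = ofCoords (1 / 2) (1 / 2) (1 / 2) (1 / 2) := rfl
    have ht' : ((t⁻¹ : ℍ[ℝ]ˣ) : ℍ[ℝ]) = ofCoords 0 (-1 / √2) (1 / √2) 0 := rfl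
    have hi0 : (i : ℍ[ℝ]) = ofCoords 0 1 0 0 := rfl
    have hw0 : (w : ℍ[ℝ]) = ofCoords (1 / 2) (-1 / 2) (-1 / 2) (-1 / 2) := rfl
    have ht0 : (t : ℍ[ℝ]) = ofCoords 0 (1 / √2) (-1 / √2) 0 := rfl
    have h2' : (√2)⁻¹ ^ 2 = (1 / 2 : ℝ) := by rw [sq, h2]
    simp only [commutatorElement_def, mul_inv_rev, inv_inv, Units.val_mul, hi', hw', ht', hi0, hw0,
      ht0, ofCoords_mul_ofCoords]
    rw [ofCoords_inj]
    refine ⟨?_, ?_, ?_, ?_⟩ <;> ring_nf <;> norm_num [h2']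
  change orderOf ((⁅t, i * w * i⁻¹⁆ : ℍ[ℝ]ˣ) : ℍ[ℝ]) = 6
  rw [hc, orderOf_ofCoords_half]

end FiniteGroups

/-- The criterion needs only finiteness and the order of one commutator, both invariant under
isomorphism. The ordering of `K` is pulled back along `σ`. -/
theorem isMaximalOrder_groupSpan_of_mulEquiv {K : Type*} [Field K] (σ : K →+* ℝ)
    {H : Type*} [Group H] [Finite H] (hH : ∃ a b : H, orderOf ⁅a, b⁆ = 6)
    (G : Subgroup ℍ[K]ˣ) (e : G ≃* H) : IsMaximalOrder (𝓞 K) K (groupSpan (𝓞 K) G) := by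
  let _ : LinearOrder K := LinearOrder.lift' σ σ.injective
  have : IsStrictOrderedRing K := Function.Injective.isStrictOrderedRing σ (map_zero σ)
    (map_one σ) (map_add σ) (map_mul σ) Iff.rfl Iff.rfl
  have : Finite G := Finite.of_equiv H e.symm.toEquiv
  obtain ⟨a, b, hab⟩ := hH
  refine isMaximalOrder_groupSpan G (e.symm a).2 (e.symm b).2 ?_
  change orderOf ((⁅e.symm a, e.symm b⁆ : G) : ℍ[K]ˣ) = 6
  rw [Subgroup.orderOf_coe, ← map_commutatorElement, MulEquiv.orderOf_eq, hab]

theorem theorem4p4 (n : ℕ) (hn : 1 ≤ n)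
    {L : Type*} [Field L] [NumberField L] [IsCyclotomicExtension {n} ℚ L]
    {K : Type*} [Field K] [Algebra K L]
    (hK : (algebraMap K L).fieldRange = NumberField.maximalRealSubfield L)
    (G : Subgroup ℍ[K]ˣ)
    (hG : Nonempty (G ≃* cliffordGroup) ∨ Nonempty (G ≃* BinaryIcosahedralGroup)) :
    IsMaximalOrder (𝓞 K) K (groupSpan (𝓞 K) G) := by
  obtain ⟨φ⟩ : Nonempty (L →+* ℂ) := inferInstance
  have hφ : NumberField.ComplexEmbedding.IsReal (φ.comp (algebraMap K L)) := by
    ext x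
    have hx : algebraMap K L x ∈ NumberField.maximalRealSubfield L := hK ▸ ⟨x, rfl⟩
    exact hx φ
  rcases hG with ⟨⟨e⟩⟩ | ⟨⟨e⟩⟩
  · exact isMaximalOrder_groupSpan_of_mulEquiv hφ.embedding
      cliffordGroup_exists_orderOf_commutator_eq_six G e
  · exact isMaximalOrder_groupSpan_of_mulEquiv hφ.embedding
      BinaryIcosahedralGroup.exists_orderOf_commutator_eq_six G e
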